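/- Let $C$ be a category with a class of morphisms called covers which form a calculus of left fractions, in the following sense: every isomorphism is a cover; covers are closed under composition; for each cover $e:V\to U$ and each morphism $u:W\to U$ of $C$ there are a cover $d:T\to W$ and a morphism $t:T\to V$ with $ud=et$; and, for each object $U$, the opposite of the full subcategory of $C\downarrow U$ consisting of the covers is filtered. Let $\mathcal F=\mathrm{Hom}(C^{\mathrm{op}},\mathrm{Cat})$ be the 2-category of pseudofunctors $C^{\mathrm{op}}\to\mathrm{Cat}$, pseudonatural transformations and modifications. (Here $\mathrm{Cat}$ consists of the categories whose objects and hom-sets have fixed universe bounds, the bound for objects being at least that for hom-sets.) For a morphism $f:X\to Y$ of $\mathcal F$ with components $f_U:XU\to YU$: * $f$ is *locally surjective on objects (l.s.o.)* when, for all objects $U$ of $C$ and $y$ of $YU$, there exist a cover $e:V\to U$, an object $x$ of $XV$ and an isomorphism $(Ye)y\cong f_Vx$. * $f$ is *cover cartesian fully faithful (c.c.f.f.)* when every $f_U$ is fully faithful and, for every cover $e:V\to U$, the square of functors $f_V\circ Xe\cong Ye\circ f_U$ (with the structural isomorphism $f_e$) is equivalent to a pseudopullback, i.e. the canonical functor from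 $XU$ to the pseudopullback of $f_V:XV\to YV$ and $Ye:YU\to YV$ is an equivalence of categories. A pair $(\mathcal S,\mathcal J)$ of classes of morphisms of a bicategory $\mathcal M$ is a *factorization system* when 1. each of $\mathcal S$ and $\mathcal J$ contains the equivalences and is closed under composition; 2. for each morphism $f$ of $\mathcal M$ there exist composable $s\in\mathcal S$, $j\in\mathcal J$ and an isomorphism $f\cong js$; 3. for each $s:X\to K$ in $\mathcal S$ and $j:Z\to Y$ in $\mathcal J$, the canonical functor from $\mathcal M(K,Z)$ to the pseudopullback of $\mathcal M(X,j):\mathcal M(X,Z)\to\mathcal M(X,Y)$ and $\mathcal M(s,Y):\mathcal M(K,Y)\to\mathcal M(X,Y)$ is an equivalence of categories. It is *regular* when, moreover, the (bicategorical) pseudopullback, along any morphism, of a morphism in $\mathcal S$ is also in $\mathcal S$. **Proposition.** The classes of l.s.o. and c.c.f.f. morphisms form a regular factorization system on $\mathcal F$ as a bicategory. -/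

import Mathlib

open CategoryTheory Bicategory Limits

open scoped CategoryTheory.Pseudofunctor.StrongTrans

universe w v u v₁ u₁ v₂ u₂ v₃ u₃ v₄ u₄

namespace DescentTheory

section Pseudopullback

variable {A : Type u₁} [Category.{v₁} A] {B : Type u₂} [Category.{v₂} B]
  {C : Type u₃} [Category.{v₃} C] {X : Type u₄} [Category.{v₄} X]

/-- The canonical functor from the vertex `X` of a square of functors
```
  X --R--> C
  |        |
  L   ≅    G
  v        v
  A --F--> B
```
commuting up to the isomorphism `σ` into the pseudopullback of `F` and `G`, whose objects are the
triples `(a, c, F a ≅ G c)`. It sends `x` to `(L x, R x, σ_x)`. -/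
abbrev comparison {F : A ⥤ B} {G : C ⥤ B} {L : X ⥤ A} {R : X ⥤ C} (σ : L ⋙ F ≅ R ⋙ G) :
    X ⥤ CategoricalPullback F G :=
  (CategoricalPullback.CatCommSqOver.toFunctorToCategoricalPullback F G X).obj ⟨L, R, σ⟩

/-- A square of functors commuting up to the isomorphism `σ` is equivalent to a pseudopullback:
its comparison functor to the pseudopullback is an equivalence of categories. -/
def IsEquivToPseudopullback {F : A ⥤ B} {G : C ⥤ B} {L : X ⥤ A} {R : X ⥤ C}
    (σ : L ⋙ F ≅ R ⋙ G) : Prop :=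
  (comparison σ).IsEquivalence

end Pseudopullback

section FactorizationSystem

variable {M : Type u} [Bicategory.{w, v} M]

/-- The square of hom-categories
```
  M(K, Z) --M(K, j)--> M(K, Y)
     |                    |
  M(s, Z)       ≅      M(s, Y)
     v                    v
  M(X, Z) --M(X, j)--> M(X, Y)
```
commutes up to the associativity isomorphisms `(s ≫ h) ≫ j ≅ s ≫ (h ≫ j)`. -/
def homSquareIso {X K Z Y : M} (s : X ⟶ K) (j : Z ⟶ Y) :
    precomp Z s ⋙ postcomp X j ≅ postcomp K j ⋙ precomp Y s :=
  NatIso.ofComponents (fun h => α_ s h j) (fun _ => by simp [precomp, postcomp])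

/-- A pair `(S, J)` of classes of morphisms is a factorization system on the bicategory `M`.
Composites are written in diagrammatic order. -/
structure IsFactorizationSystem (S J : MorphismProperty M) : Prop where
  left_equivalence {X Y : M} (e : X ≌ Y) : S e.hom
  right_equivalence {X Y : M} (e : X ≌ Y) : J e.hom
  left_comp {X Y Z : M} (f : X ⟶ Y) (g : Y ⟶ Z) : S f → S g → S (f ≫ g)
  right_comp {X Y Z : M} (f : X ⟶ Y) (g : Y ⟶ Z) : J f → J g → J (f ≫ g)
  exists_factorization {X Y : M} (f : X ⟶ Y) :
    ∃ (Z : M) (s : X ⟶ Z) (j : Z ⟶ Y), S s ∧ J j ∧ Nonempty (f ≅ s ≫ j)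
  fill_in {X K Z Y : M} (s : X ⟶ K) (j : Z ⟶ Y) : S s → J j →
    IsEquivToPseudopullback (homSquareIso s j)

/-- The square of hom-categories obtained by applying `M(W, -)` to a square
`θ : p ≫ f ≅ q ≫ g` in `M`. -/
def representedSquareIso {P X Y Z : M} {p : P ⟶ X} {q : P ⟶ Y} {f : X ⟶ Z} {g : Y ⟶ Z}
    (θ : p ≫ f ≅ q ≫ g) (W : M) :
    postcomp W p ⋙ postcomp W f ≅ postcomp W q ⋙ postcomp W g :=
  NatIso.ofComponents (fun h => α_ h p f ≪≫ whiskerLeftIso h θ ≪≫ (α_ h q g).symm)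
    (fun {h k} β => by
      simp only [postcomp, Functor.comp_map, Iso.trans_hom, Iso.symm_hom,
        whiskerLeftIso_hom, Category.assoc]
      rw [associator_naturality_left_assoc, ← whisker_exchange_assoc,
        associator_inv_naturality_left])

/-- The square `θ : p ≫ f ≅ q ≫ g` exhibits `P` as a pseudopullback of `f` and `g` in the
bicategory `M`: each `M(W, -)` takes it to a pseudopullback of categories, up to equivalence. -/
def IsPseudopullback {P X Y Z : M} {p : P ⟶ X} {q : P ⟶ Y} {f : X ⟶ Z} {g : Y ⟶ Z}
    (θ : p ≫ f ≅ q ≫ g) : Prop :=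
  ∀ W : M, IsEquivToPseudopullback (representedSquareIso θ W)

/-- A factorization system `(S, J)` is regular when the pseudopullback `q` of a morphism `f` in `S`
along any morphism `g` is in `S`. -/
structure IsRegularFactorizationSystem (S J : MorphismProperty M) : Prop
    extends IsFactorizationSystem S J where
  left_pseudopullback {P X Y Z : M} {p : P ⟶ X} {q : P ⟶ Y} {f : X ⟶ Z} {g : Y ⟶ Z}
    (θ : p ≫ f ≅ q ≫ g) : IsPseudopullback θ → S f → S q

end FactorizationSystem

section Covers

variable {C : Type u} [Category.{v} C]

/-- The class `Cov` of covers is a calculus of fractions in `C`: it contains the isomorphisms, is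
closed under composition, satisfies the Ore condition, and for each `U` the opposite of the full
subcategory of `C ↓ U` on the covers is filtered. -/
structure IsCalculusOfFractions (Cov : MorphismProperty C) : Prop where
  of_isIso {V U : C} (e : V ⟶ U) : IsIso e → Cov e
  comp {W V U : C} (d : W ⟶ V) (e : V ⟶ U) : Cov d → Cov e → Cov (d ≫ e)
  ore {V U W : C} (e : V ⟶ U) (u : W ⟶ U) : Cov e →
    ∃ (T : C) (d : T ⟶ W) (t : T ⟶ V), Cov d ∧ d ≫ u = t ≫ e
  isFiltered (U : C) : IsFiltered ((Cov.overObj (X := U)).FullSubcategory)ᵒᵖ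

end Covers

section Parametrized

set_option linter.checkUnivs false in
/-- The 2-category `F = Hom(Cᵒᵖ, Cat)` of pseudofunctors, pseudonatural transformations and
modifications, with the bicategory structure of Mathlib. Here `Cat` consists of the categories with
hom-sets in `Type v₂` and objects in `Type (max u₂ v₂)`. -/
abbrev ParamCat (C : Type u) [Category.{v} C] : Type _ :=
  LocallyDiscrete Cᵒᵖ ⥤ᵖ Cat.{v₂, max u₂ v₂}

variable {C : Type u} [Category.{v} C]

namespace ParamCat

/-- The category `X U`. -/
abbrev fiber (X : ParamCat.{v, u, v₂, u₂} C) (U : C) : Cat.{v₂, max u₂ v₂} :=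
  X.obj ⟨.op U⟩

/-- The functor `X e : X U ⥤ X V` for `e : V ⟶ U`. -/
abbrev restr (X : ParamCat.{v, u, v₂, u₂} C) {V U : C} (e : V ⟶ U) : X.fiber U ⥤ X.fiber V :=
  (X.map e.op.toLoc).toFunctor

variable {X Y : ParamCat.{v, u, v₂, u₂} C}

/-- The component `f_U : X U ⥤ Y U`. -/
abbrev component (f : X ⟶ Y) (U : C) : X.fiber U ⥤ Y.fiber U :=
  (f.app ⟨.op U⟩).toFunctor

/-- The naturality isomorphism `f_e` of the square
```
  X U --f_U--> Y U
   |            |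
  X e    ≅     Y e
   v            v
  X V --f_V--> Y V
```
for `e : V ⟶ U`. -/
abbrev naturalityIso (f : X ⟶ Y) {V U : C} (e : V ⟶ U) :
    X.restr e ⋙ component f V ≅ component f U ⋙ Y.restr e :=
  Cat.Hom.toNatIso (f.naturality e.op.toLoc)

end ParamCat

open ParamCat

/-- The class of locally surjective on objects (l.s.o.) morphisms. -/
def lso (Cov : MorphismProperty C) : MorphismProperty (ParamCat.{v, u, v₂, u₂} C) :=
  fun X Y f => ∀ (U : C) (y : Y.fiber U),
    ∃ (V : C) (e : V ⟶ U) (x : X.fiber V),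
      Cov e ∧ Nonempty ((Y.restr e).obj y ≅ (component f V).obj x)

/-- The class of cover cartesian fully faithful (c.c.f.f.) morphisms. -/
def ccff (Cov : MorphismProperty C) : MorphismProperty (ParamCat.{v, u, v₂, u₂} C) :=
  fun _ _ f => (∀ U : C, (component f U).Full ∧ (component f U).Faithful) ∧
    ∀ {V U : C} (e : V ⟶ U), Cov e → IsEquivToPseudopullback (naturalityIso f e)

end Parametrized

end DescentTheory

/-! A fully faithful `f` is c.c.f.f. exactly when its essential image descends along covers: if
`(Ye)y` is isomorphic to a value of `f_V`, then `y` is isomorphic to a value of `f_U` (`ccff_iff`).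

For the fill-in condition, postcomposition with a fully faithful `j` is fully faithful, so by
`isEquivToPseudopullback_iff` only a lift of `q : K ⟶ Y` through `j` is needed. By `exists_lift`
such a lift exists as soon as every value of `q` is isomorphic to a value of `j`. An object of `K U`
comes from `X` on a cover, where `q` agrees with `j` after `p`, and descent for `j` concludes.

To factor `f : X ⟶ Y`, take the full subpseudofunctor of `Y` on the objects that are locally values
of `f`. The Ore condition makes it stable under restriction, composition of covers makes it descend,
and `exists_lift` supplies the first factor.

For regularity, the universal property of the given pseudopullback is tested on one object, the
pointwise pseudopullback; only essential surjectivity of that comparison is needed. -/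

namespace DescentTheory

/-! ### Postcomposition with a fully faithful transformation -/

section FullyFaithful

variable {B : Type u} [Bicategory.{w, v} B]

section Components

variable {X Y Z : B ⥤ᵖ Cat.{v₁, u₁}}

theorem naturality_map_hom (f : X ⟶ Y) {a b : B} (u : a ⟶ b)
    {x x' : X.obj a} (φ : x ⟶ x') :
    (f.app b).toFunctor.map ((X.map u).toFunctor.map φ) ≫
        (f.naturality u).hom.toNatTrans.app x' =
      (f.naturality u).hom.toNatTrans.app x ≫
        (Y.map u).toFunctor.map ((f.app a).toFunctor.map φ) :=
  (f.naturality u).hom.toNatTrans.naturality φ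

theorem modification_naturality_app {f g : X ⟶ Y} (m : f ⟶ g)
    {a b : B} (u : a ⟶ b) (x : X.obj a) :
    (m.as.app b).toNatTrans.app ((X.map u).toFunctor.obj x) ≫
        (g.naturality u).hom.toNatTrans.app x =
      (f.naturality u).hom.toNatTrans.app x ≫
        (Y.map u).toFunctor.map ((m.as.app a).toNatTrans.app x) :=
  congr(($(m.as.naturality u)).toNatTrans.app x)

theorem comp_naturality_app (f : X ⟶ Y) (g : Y ⟶ Z)
    {a b : B} (u : a ⟶ b) (x : X.obj a) :
    ((f ≫ g).naturality u).hom.toNatTrans.app x =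
      (g.app b).toFunctor.map ((f.naturality u).hom.toNatTrans.app x) ≫
        (g.naturality u).hom.toNatTrans.app ((f.app a).toFunctor.obj x) := by
  simp only [Pseudofunctor.StrongTrans.categoryStruct_comp_naturality_hom]
  -- The constraint of a composite contains three associators of `Cat`, whose components are
  -- identities; they are stripped one at a time.
  refine (Category.id_comp _).trans (congrArg _ ((Category.id_comp _).trans ?_))
  exact Category.comp_id _

/-- A modification between pseudonatural transformations into `Cat`, given objectwise. -/
def modificationOfComponents {f g : X ⟶ Y}
    (app : ∀ a (x : X.obj a), (f.app a).toFunctor.obj x ⟶ (g.app a).toFunctor.obj x)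
    (naturality : ∀ a {x y : X.obj a} (φ : x ⟶ y),
      (f.app a).toFunctor.map φ ≫ app a y = app a x ≫ (g.app a).toFunctor.map φ)
    (naturality' : ∀ {a b} (u : a ⟶ b) (x : X.obj a),
      app b ((X.map u).toFunctor.obj x) ≫ (g.naturality u).hom.toNatTrans.app x =
        (f.naturality u).hom.toNatTrans.app x ≫ (Y.map u).toFunctor.map (app a x)) :
    f ⟶ g where
  as :=
    { app a := ⟨⟨app a, fun _ _ φ => naturality a φ⟩⟩
      naturality u := by
        ext x
        exact naturality' u x }

/-- An isomorphism between pseudonatural transformations into `Cat`, given objectwise. -/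
def isoOfComponents {f g : X ⟶ Y}
    (app : ∀ a (x : X.obj a), (f.app a).toFunctor.obj x ≅ (g.app a).toFunctor.obj x)
    (naturality : ∀ a {x y : X.obj a} (φ : x ⟶ y),
      (f.app a).toFunctor.map φ ≫ (app a y).hom = (app a x).hom ≫ (g.app a).toFunctor.map φ)
    (naturality' : ∀ {a b} (u : a ⟶ b) (x : X.obj a),
      (app b ((X.map u).toFunctor.obj x)).hom ≫ (g.naturality u).hom.toNatTrans.app x =
        (f.naturality u).hom.toNatTrans.app x ≫ (Y.map u).toFunctor.map (app a x).hom) :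
    f ≅ g :=
  Pseudofunctor.StrongTrans.isoMk
    (fun a => Cat.Hom.isoMk (NatIso.ofComponents (app a) (naturality a)))
    (fun u => by
      ext x
      exact naturality' u x)

end Components

/-- A morphism of pseudofunctors into `Cat` all of whose components are fully faithful. -/
def IsFullyFaithful {Z Y : B ⥤ᵖ Cat.{v₁, u₁}} (j : Z ⟶ Y) : Prop :=
  ∀ a, (j.app a).toFunctor.Full ∧ (j.app a).toFunctor.Faithful

variable {W Z Y K : B ⥤ᵖ Cat.{v₁, u₁}} {j : Z ⟶ Y}

theorem faithful_postcomp (hj : IsFullyFaithful j) : (postcomp W j).Faithful where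
  map_injective {h k} m m' e := by
    ext a x
    have := (hj a).2
    apply (j.app a).toFunctor.map_injective
    exact congr(($(e).as.app a).toNatTrans.app x)

/-- Preimages under the components of `j` give the 2-cell; since `j` is faithful, its axioms may be
checked after applying `j`, where they are those of `n`. -/
theorem exists_whiskerRight_eq (hj : IsFullyFaithful j) {h k : W ⟶ Z} (n : h ≫ j ⟶ k ≫ j) :
    ∃ m : h ⟶ k, m ▷ j = n := by
  have := fun a => (hj a).1
  have := fun a => (hj a).2
  let app (a : B) (x : W.obj a) : (h.app a).toFunctor.obj x ⟶ (k.app a).toFunctor.obj x :=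
    (j.app a).toFunctor.preimage ((n.as.app a).toNatTrans.app x)
  have map_app (a : B) (x : W.obj a) :
      (j.app a).toFunctor.map (app a x) = (n.as.app a).toNatTrans.app x :=
    (j.app a).toFunctor.map_preimage _
  refine ⟨modificationOfComponents app (fun a {x y} φ => ?_) (fun {a b} u x => ?_), ?_⟩
  · apply (j.app a).toFunctor.map_injective
    rw [Functor.map_comp, Functor.map_comp, map_app, map_app]
    exact (n.as.app a).toNatTrans.naturality φ
  · apply (j.app b).toFunctor.map_injective
    have h1 := modification_naturality_app n u x
    rw [comp_naturality_app, comp_naturality_app, ← map_app, ← map_app] at h1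
    have h2 := naturality_map_hom j u (app a x)
    rw [Functor.map_comp, Functor.map_comp, ← cancel_mono
      ((j.naturality u).hom.toNatTrans.app ((k.app a).toFunctor.obj x)),
      Category.assoc, Category.assoc]
    refine h1.trans ((Category.assoc _ _ _).trans ?_)
    exact congrArg _ h2.symm
  · ext a x
    exact map_app a x

theorem full_postcomp (hj : IsFullyFaithful j) : (postcomp W j).Full where
  map_surjective n := exists_whiskerRight_eq hj n

end FullyFaithful

/-! ### Lifting through a fully faithful transformation -/

section Lifting

variable {B : Type u} [Bicategory.{w, v} B]

section Components

variable {X Y : B ⥤ᵖ Cat.{v₁, u₁}}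

theorem naturality_naturality_app (f : X ⟶ Y) {a b : B} {u u' : a ⟶ b} (η : u ⟶ u')
    (x : X.obj a) :
    (f.app b).toFunctor.map ((X.map₂ η).toNatTrans.app x) ≫
        (f.naturality u').hom.toNatTrans.app x =
      (f.naturality u).hom.toNatTrans.app x ≫
        (Y.map₂ η).toNatTrans.app ((f.app a).toFunctor.obj x) :=
  congr(($(f.naturality_naturality η)).toNatTrans.app x)

theorem naturality_id_app (f : X ⟶ Y) (a : B) (x : X.obj a) :
    (f.naturality (𝟙 a)).hom.toNatTrans.app x ≫
        (Y.mapId a).hom.toNatTrans.app ((f.app a).toFunctor.obj x) =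
      (f.app a).toFunctor.map ((X.mapId a).hom.toNatTrans.app x) := by
  refine congr(($(f.naturality_id a)).toNatTrans.app x).trans ?_
  exact (congrArg _ (Category.id_comp _)).trans (Category.comp_id _)

theorem naturality_comp_app (f : X ⟶ Y) {a b c : B} (u : a ⟶ b) (t : b ⟶ c) (x : X.obj a) :
    (f.naturality (u ≫ t)).hom.toNatTrans.app x ≫
        (Y.mapComp u t).hom.toNatTrans.app ((f.app a).toFunctor.obj x) =
      (f.app c).toFunctor.map ((X.mapComp u t).hom.toNatTrans.app x) ≫
        (f.naturality t).hom.toNatTrans.app ((X.map u).toFunctor.obj x) ≫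
          (Y.map t).toFunctor.map ((f.naturality u).hom.toNatTrans.app x) := by
  refine congr(($(f.naturality_comp u t)).toNatTrans.app x).trans ?_
  refine congrArg _ ((Category.id_comp _).trans (congrArg _ ((Category.id_comp _).trans ?_)))
  exact Category.comp_id _

/-- A pseudonatural transformation into `Cat`, given objectwise. -/
def transOfComponents (app : ∀ a, X.obj a ⥤ Y.obj a)
    (nat : ∀ {a b : B} (u : a ⟶ b) (x : X.obj a),
      (app b).obj ((X.map u).toFunctor.obj x) ≅ (Y.map u).toFunctor.obj ((app a).obj x))
    (nat_map : ∀ {a b : B} (u : a ⟶ b) {x x' : X.obj a} (φ : x ⟶ x'),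
      (app b).map ((X.map u).toFunctor.map φ) ≫ (nat u x').hom =
        (nat u x).hom ≫ (Y.map u).toFunctor.map ((app a).map φ))
    (nat_nat : ∀ {a b : B} {u u' : a ⟶ b} (η : u ⟶ u') (x : X.obj a),
      (app b).map ((X.map₂ η).toNatTrans.app x) ≫ (nat u' x).hom =
        (nat u x).hom ≫ (Y.map₂ η).toNatTrans.app ((app a).obj x))
    (nat_id : ∀ (a : B) (x : X.obj a),
      (nat (𝟙 a) x).hom ≫ (Y.mapId a).hom.toNatTrans.app ((app a).obj x) =
        (app a).map ((X.mapId a).hom.toNatTrans.app x))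
    (nat_comp : ∀ {a b c : B} (u : a ⟶ b) (t : b ⟶ c) (x : X.obj a),
      (nat (u ≫ t) x).hom ≫ (Y.mapComp u t).hom.toNatTrans.app ((app a).obj x) =
        (app c).map ((X.mapComp u t).hom.toNatTrans.app x) ≫
          (nat t ((X.map u).toFunctor.obj x)).hom ≫ (Y.map t).toFunctor.map (nat u x).hom) :
    X ⟶ Y where
  app a := (app a).toCatHom
  naturality u := Cat.Hom.isoMk (F := (X.map u).toFunctor ⋙ app _)
    (G := app _ ⋙ (Y.map u).toFunctor) (NatIso.ofComponents (nat u) (nat_map u))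
  naturality_naturality η := by
    ext x
    exact nat_nat η x
  naturality_id a := by
    ext x
    refine (nat_id a x).trans ?_
    exact ((congrArg _ (Category.id_comp _)).trans (Category.comp_id _)).symm
  naturality_comp u t := by
    ext x
    refine (nat_comp u t x).trans (Eq.symm ?_)
    refine congrArg _ ((Category.id_comp _).trans (congrArg _ ((Category.id_comp _).trans ?_)))
    exact Category.comp_id _

end Components

variable {Z Y K : B ⥤ᵖ Cat.{v₁, u₁}} {j : Z ⟶ Y}

/-- Choose a preimage of each object up to isomorphism and transport everything else along the
chosen isomorphisms `e`. Full faithfulness makes the transported data unique, so each coherence law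
for `h` follows, after applying `j`, from those of `q` and `j`. -/
theorem exists_lift (hj : IsFullyFaithful j) (q : K ⟶ Y)
    (hq : ∀ (a : B) (k : K.obj a), ∃ z : Z.obj a,
      Nonempty ((j.app a).toFunctor.obj z ≅ (q.app a).toFunctor.obj k)) :
    ∃ h : K ⟶ Z, Nonempty (h ≫ j ≅ q) := by
  have := fun a => (hj a).1
  have := fun a => (hj a).2
  choose o ho using hq
  let e (a : B) (k : K.obj a) : (j.app a).toFunctor.obj (o a k) ≅ (q.app a).toFunctor.obj k :=
    (ho a k).some
  let app (a : B) : K.obj a ⥤ Z.obj a :=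
    { obj := o a
      map φ := (j.app a).toFunctor.preimage
        ((e a _).hom ≫ (q.app a).toFunctor.map φ ≫ (e a _).inv)
      map_id k := (j.app a).toFunctor.map_injective (by simp)
      map_comp φ ψ := (j.app a).toFunctor.map_injective (by simp) }
  have app_map (a : B) {k k' : K.obj a} (φ : k ⟶ k') :
      (j.app a).toFunctor.map ((app a).map φ) =
        (e a k).hom ≫ (q.app a).toFunctor.map φ ≫ (e a k').inv :=
    (j.app a).toFunctor.map_preimage _
  let nat {a b : B} (u : a ⟶ b) (k : K.obj a) :
      (app b).obj ((K.map u).toFunctor.obj k) ≅ (Z.map u).toFunctor.obj ((app a).obj k) :=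
    (j.app b).toFunctor.preimageIso (e b _ ≪≫ (Cat.Hom.toNatIso (q.naturality u)).app k ≪≫
      (Y.map u).toFunctor.mapIso (e a k).symm ≪≫
        (Cat.Hom.toNatIso (j.naturality u)).symm.app (o a k))
  -- This equation says that `e` is compatible with restriction; it is the only property of `nat`
  -- used below.
  have map_nat {a b : B} (u : a ⟶ b) (k : K.obj a) :
      (j.app b).toFunctor.map (nat u k).hom ≫
          (j.naturality u).hom.toNatTrans.app ((app a).obj k) =
        (e b _).hom ≫ (q.naturality u).hom.toNatTrans.app k ≫
          (Y.map u).toFunctor.map (e a k).inv := by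
    refine (congrArg (· ≫ _) ((j.app b).toFunctor.map_preimage _)).trans ?_
    simp [app]
  let h : K ⟶ Z := by
    refine transOfComponents app nat (fun {a b} u {k k'} φ => ?_) (fun {a b u u'} η k => ?_)
      (fun a k => ?_) (fun {a b c} u t k => ?_)
    · apply (j.app b).toFunctor.map_injective
      rw [Functor.map_comp, Functor.map_comp, ← cancel_mono
        ((j.naturality u).hom.toNatTrans.app ((app a).obj k')), Category.assoc, Category.assoc,
        map_nat, naturality_map_hom, reassoc_of% (map_nat u k), app_map, app_map]
      simp only [Category.assoc, Functor.map_comp, Iso.inv_hom_id_assoc, Iso.map_inv_hom_id_assoc]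
      rw [reassoc_of% @naturality_map_hom]
    · apply (j.app b).toFunctor.map_injective
      rw [Functor.map_comp, Functor.map_comp, ← cancel_mono
        ((j.naturality u').hom.toNatTrans.app ((app a).obj k)), Category.assoc, Category.assoc,
        map_nat, naturality_naturality_app, reassoc_of% (map_nat u k), app_map]
      simp only [Category.assoc, Iso.inv_hom_id_assoc]
      rw [reassoc_of% @naturality_naturality_app]
      exact congrArg (fun m => (e b _).hom ≫ (q.naturality u).hom.toNatTrans.app k ≫ m)
        ((Y.map₂ η).toNatTrans.naturality (e a k).inv).symm
    · apply (j.app a).toFunctor.map_injective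
      rw [Functor.map_comp, ← naturality_id_app, reassoc_of% (map_nat (𝟙 a) k), app_map,
        ← naturality_id_app]
      simp only [Category.assoc]
      exact congrArg (fun m => (e a _).hom ≫ (q.naturality (𝟙 a)).hom.toNatTrans.app k ≫ m)
        ((Y.mapId a).hom.toNatTrans.naturality (e a k).inv)
    · apply (j.app c).toFunctor.map_injective
      have h1 := (Y.mapComp u t).hom.toNatTrans.naturality (e a k).inv
      have h2 := congrArg ((Y.map t).toFunctor.map) (map_nat u k)
      rw [Functor.map_comp, Functor.map_comp] at h2
      rw [Functor.map_comp, Functor.map_comp, Functor.map_comp, ← cancel_mono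
        ((j.naturality t).hom.toNatTrans.app _ ≫
          (Y.map t).toFunctor.map ((j.naturality u).hom.toNatTrans.app _))]
      simp only [Category.assoc]
      have h3 : (j.app c).toFunctor.map ((app c).map ((K.mapComp u t).hom.toNatTrans.app k)) =
          (e c _).hom ≫ (q.app c).toFunctor.map ((K.mapComp u t).hom.toNatTrans.app k) ≫
            (e c ((K.map t).toFunctor.obj ((K.map u).toFunctor.obj k))).inv := app_map c _
      rw [← naturality_comp_app, reassoc_of% (map_nat (u ≫ t) k),
        reassoc_of% @naturality_map_hom, h2, reassoc_of% (map_nat t), h3]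
      simp only [Functor.map_comp, Category.assoc, Iso.inv_hom_id_assoc, Iso.map_inv_hom_id_assoc]
      rw [← reassoc_of% @naturality_comp_app]
      exact congrArg (fun m => (e c _).hom ≫ (q.naturality (u ≫ t)).hom.toNatTrans.app k ≫ m) h1
  refine ⟨h, ⟨isoOfComponents e (fun a {k k'} φ => ?_) (fun {a b} u k => ?_)⟩⟩
  · refine (congrArg (· ≫ _) (app_map a φ)).trans ?_
    simp only [Category.assoc, Iso.inv_hom_id, Category.comp_id]
    rfl
  · have h1 : (e b ((K.map u).toFunctor.obj k)).hom ≫ (q.naturality u).hom.toNatTrans.app k =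
        ((e b _).hom ≫ (q.naturality u).hom.toNatTrans.app k ≫
          (Y.map u).toFunctor.map (e a k).inv) ≫ (Y.map u).toFunctor.map (e a k).hom := by
      simp
    have h2 : ((h ≫ j).naturality u).hom.toNatTrans.app k = _ :=
      (comp_naturality_app h j u k).trans (map_nat u k)
    exact h1.trans (congrArg (· ≫ _) h2.symm)

end Lifting

/-! ### Pseudopullbacks with two fully faithful parallel sides -/

section Pseudopullback

variable {A : Type u₁} [Category.{v₁} A] {B : Type u₂} [Category.{v₂} B]
  {C : Type u₃} [Category.{v₃} C] {X : Type u₄} [Category.{v₄} X]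

/-- When two parallel sides of a square are fully faithful, it is a pseudopullback as soon as the
essential image of the one is the inverse image of the essential image of the other. -/
theorem isEquivToPseudopullback_iff {F : A ⥤ B} {G : C ⥤ B} {L : X ⥤ A} {R : X ⥤ C}
    (σ : L ⋙ F ≅ R ⋙ G) [F.Full] [F.Faithful] [R.Full] [R.Faithful] :
    IsEquivToPseudopullback σ ↔
      ∀ (a : A) (c : C), Nonempty (F.obj a ≅ G.obj c) → ∃ x : X, Nonempty (R.obj x ≅ c) := by
  constructor
  · rintro h a c ⟨i⟩
    obtain ⟨x, ⟨k⟩⟩ := h.essSurj.mem_essImage ⟨a, c, i⟩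
    exact ⟨x, ⟨(CategoricalPullback.π₂ _ _).mapIso k⟩⟩
  · intro h
    refine ⟨⟨fun {x x'} m m' hm => ?_⟩, ⟨fun {x x'} n => ?_⟩, ⟨?_⟩⟩
    · exact R.map_injective congr(($hm).snd)
    · obtain ⟨m, hm⟩ := R.map_surjective n.snd
      have h1 : F.map n.fst ≫ σ.hom.app x' = σ.hom.app x ≫ G.map n.snd := n.w
      have h2 : F.map (L.map m) ≫ σ.hom.app x' = σ.hom.app x ≫ G.map (R.map m) :=
        σ.hom.naturality m
      refine ⟨m, CategoricalPullback.hom_ext (F.map_injective ?_) hm⟩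
      exact (cancel_mono (σ.hom.app x')).1
        (h2.trans ((congrArg (fun t => σ.hom.app x ≫ G.map t) hm).trans h1.symm))
    · rintro ⟨a, c, i⟩
      obtain ⟨x, ⟨k⟩⟩ := h a c ⟨i⟩
      -- `F (L x) ≅ G (R x) ≅ G c ≅ F a`, and `F` reflects this to `L x ≅ a`.
      refine ⟨x, ⟨CategoricalPullback.mkIso
        (F.preimageIso (σ.app x ≪≫ G.mapIso k ≪≫ i.symm)) k ?_⟩⟩
      refine (congrArg (· ≫ i.hom) (F.map_preimage _)).trans ?_
      change (σ.hom.app x ≫ G.map k.hom ≫ i.inv) ≫ i.hom = σ.hom.app x ≫ G.map k.hom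
      simp only [Category.assoc, Iso.inv_hom_id, Category.comp_id]

end Pseudopullback

/-! ### The two classes: closure properties, fill-in and factorization -/

section Classes

variable {C : Type u} [Category.{v} C] {Cov : MorphismProperty C}

open ParamCat

variable {X Y Z : ParamCat.{v, u, v₂, u₂} C}

theorem isFullyFaithful_iff (f : X ⟶ Y) :
    IsFullyFaithful f ↔ ∀ U : C, (component f U).Full ∧ (component f U).Faithful :=
  ⟨fun h U => h ⟨.op U⟩, fun h a => h a.as.unop⟩

theorem isEquivToPseudopullback_naturalityIso_iff {f : X ⟶ Y} (hf : IsFullyFaithful f)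
    {V U : C} (e : V ⟶ U) :
    IsEquivToPseudopullback (naturalityIso f e) ↔
      ∀ (x : X.fiber V) (y : Y.fiber U),
        Nonempty ((component f V).obj x ≅ (Y.restr e).obj y) →
          ∃ x' : X.fiber U, Nonempty ((component f U).obj x' ≅ y) := by
  have := fun U => ((isFullyFaithful_iff f).1 hf U).1
  have := fun U => ((isFullyFaithful_iff f).1 hf U).2
  exact isEquivToPseudopullback_iff _

theorem ccff_iff {f : X ⟶ Y} :
    ccff Cov f ↔ IsFullyFaithful f ∧ ∀ {V U : C} (e : V ⟶ U), Cov e →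
      ∀ (x : X.fiber V) (y : Y.fiber U),
        Nonempty ((component f V).obj x ≅ (Y.restr e).obj y) →
          ∃ x' : X.fiber U, Nonempty ((component f U).obj x' ≅ y) := by
  rw [ccff, ← isFullyFaithful_iff]
  refine and_congr_right fun hf => forall_congr' fun V => forall_congr' fun U =>
    forall_congr' fun e => forall_congr' fun _ => ?_
  exact isEquivToPseudopullback_naturalityIso_iff hf e

/-- The isomorphism `X (d ≫ e) ≅ X e ⋙ X d`, objectwise. -/
def restrCompIso (X : ParamCat.{v, u, v₂, u₂} C) {W V U : C} (d : W ⟶ V) (e : V ⟶ U)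
    (x : X.fiber U) :
    (X.restr (d ≫ e)).obj x ≅ (X.restr d).obj ((X.restr e).obj x) :=
  (Cat.Hom.toNatIso (X.mapComp e.op.toLoc d.op.toLoc)).app x

/-- The isomorphism `X (𝟙 U) ≅ 𝟭`, objectwise. -/
def restrIdIso (X : ParamCat.{v, u, v₂, u₂} C) {U : C} (x : X.fiber U) :
    (X.restr (𝟙 U)).obj x ≅ x :=
  (Cat.Hom.toNatIso (X.mapId ⟨.op U⟩)).app x

/-- The component at `x` of a 2-cell of `F` which is invertible. -/
def appIso {f g : X ⟶ Y} (m : f ≅ g) {U : C} (x : X.fiber U) :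
    (component f U).obj x ≅ (component g U).obj x :=
  ⟨(m.hom.as.app ⟨.op U⟩).toNatTrans.app x, (m.inv.as.app ⟨.op U⟩).toNatTrans.app x,
    congr(($(m.hom_inv_id).as.app ⟨.op U⟩).toNatTrans.app x),
    congr(($(m.inv_hom_id).as.app ⟨.op U⟩).toNatTrans.app x)⟩

theorem lso_comp (hCov : IsCalculusOfFractions Cov) {f : X ⟶ Y} {g : Y ⟶ Z}
    (hf : lso Cov f) (hg : lso Cov g) : lso Cov (f ≫ g) := by
  intro U z
  obtain ⟨V, e, y, he, ⟨i⟩⟩ := hg U z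
  obtain ⟨W, d, x, hd, ⟨k⟩⟩ := hf V y
  exact ⟨W, d ≫ e, x, hCov.comp d e hd he, ⟨restrCompIso Z d e z ≪≫ (Z.restr d).mapIso i ≪≫
    ((naturalityIso g d).app y).symm ≪≫ (component g W).mapIso k⟩⟩

theorem ccff_comp {f : X ⟶ Y} {g : Y ⟶ Z} (hf : ccff Cov f) (hg : ccff Cov g) :
    ccff Cov (f ≫ g) := by
  rw [ccff_iff] at hf hg ⊢
  refine ⟨fun a => ?_, fun {V U} e he x z ⟨i⟩ => ?_⟩
  · have := (hf.1 a).1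
    have := (hf.1 a).2
    have := (hg.1 a).1
    have := (hg.1 a).2
    exact ⟨inferInstanceAs ((f.app a).toFunctor ⋙ (g.app a).toFunctor).Full,
      inferInstanceAs ((f.app a).toFunctor ⋙ (g.app a).toFunctor).Faithful⟩
  · obtain ⟨y, ⟨k⟩⟩ := hg.2 e he ((component f V).obj x) z ⟨i⟩
    have := (hg.1 ⟨.op V⟩).1
    have := (hg.1 ⟨.op V⟩).2
    -- Full faithfulness of `g_V` turns `g_V (f_V x) ≅ g_V ((Ye)y)` into the hypothesis for descent
    -- along `f`.
    obtain ⟨x', ⟨l⟩⟩ := hf.2 e he x y ⟨(component g V).preimageIso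
      (i ≪≫ (Z.restr e).mapIso k.symm ≪≫ ((naturalityIso g e).app y).symm)⟩
    exact ⟨x', ⟨(component g U).mapIso l ≪≫ k⟩⟩

theorem exists_iso_of_equivalence (e : X ≌ Y) {U : C} (y : Y.fiber U) :
    ∃ x : X.fiber U, Nonempty ((component e.hom U).obj x ≅ y) :=
  ⟨(component e.inv U).obj y, ⟨appIso e.counit y⟩⟩

theorem isFullyFaithful_of_equivalence (e : X ≌ Y) : IsFullyFaithful e.hom := by
  intro a
  let E : CategoryTheory.Equivalence (X.obj a) (Y.obj a) :=
    CategoryTheory.Equivalence.mk (e.hom.app a).toFunctor (e.inv.app a).toFunctor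
    (NatIso.ofComponents (fun x => appIso (U := a.as.unop) e.unit x)
      (fun φ => (e.unit.hom.as.app a).toNatTrans.naturality φ))
    (NatIso.ofComponents (fun x => appIso (U := a.as.unop) e.counit x)
      (fun φ => (e.counit.hom.as.app a).toNatTrans.naturality φ))
  exact ⟨inferInstanceAs E.functor.Full, inferInstanceAs E.functor.Faithful⟩

theorem lso_of_equivalence (hCov : IsCalculusOfFractions Cov) (e : X ≌ Y) :
    lso Cov e.hom := by
  intro U y
  obtain ⟨x, ⟨i⟩⟩ := exists_iso_of_equivalence e y
  exact ⟨U, 𝟙 U, x, hCov.of_isIso _ inferInstance, ⟨restrIdIso Y y ≪≫ i.symm⟩⟩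

theorem ccff_of_equivalence (e : X ≌ Y) : ccff Cov e.hom :=
  ccff_iff.2 ⟨isFullyFaithful_of_equivalence e, fun _ _ _ y _ => exists_iso_of_equivalence e y⟩

theorem isEquivToPseudopullback_of_lso_of_ccff {K : ParamCat.{v, u, v₂, u₂} C} {s : X ⟶ K}
    {j : Z ⟶ Y} (hs : lso Cov s) (hj : ccff Cov j) :
    IsEquivToPseudopullback (homSquareIso s j) := by
  rw [ccff_iff] at hj
  have := fun W => full_postcomp (W := W) hj.1
  have := fun W => faithful_postcomp (W := W) hj.1
  rw [isEquivToPseudopullback_iff]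
  rintro p q ⟨σ⟩
  refine exists_lift hj.1 q fun a k => ?_
  obtain ⟨V, e, x, he, ⟨i⟩⟩ := hs a.as.unop k
  -- `j p x ≅ q s x ≅ q ((Ke)k) ≅ (Ye)(q k)`, so `q k` is locally a value of `j`.
  exact hj.2 e he ((component p V).obj x) ((component q a.as.unop).obj k)
    ⟨appIso σ x ≪≫ (component q V).mapIso i.symm ≪≫ (naturalityIso q e).app k⟩

/-- The objects of `Y U` which are, on some cover, isomorphic to a value of `f`. -/
def localImage (Cov : MorphismProperty C) (f : X ⟶ Y) : Pseudofunctor.ObjectProperty Y where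
  prop a y := ∃ (V : C) (e : V ⟶ a.as.unop) (x : X.fiber V),
    Cov e ∧ Nonempty ((Y.restr e).obj y ≅ (component f V).obj x)

/-- The Ore condition pulls a cover witnessing membership back along the restriction map. -/
theorem isClosedUnderMapObj_localImage (hCov : IsCalculusOfFractions Cov) (f : X ⟶ Y) :
    (localImage Cov f).IsClosedUnderMapObj where
  map_obj {a b y} hy u := by
    obtain ⟨V, e, x, he, ⟨i⟩⟩ := hy
    obtain ⟨T, d, t, hd, h⟩ := hCov.ore e u.as.unop he
    refine ⟨T, d, (X.restr t).obj x, hd, ⟨(restrCompIso Y d u.as.unop y).symm ≪≫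
      eqToIso (by rw [h]) ≪≫ restrCompIso Y t e y ≪≫ (Y.restr t).mapIso i ≪≫
        ((naturalityIso f t).app x).symm⟩⟩

theorem exists_lso_ccff_factorization (hCov : IsCalculusOfFractions Cov) (f : X ⟶ Y) :
    ∃ (Z : ParamCat.{v, u, v₂, u₂} C) (s : X ⟶ Z) (j : Z ⟶ Y),
      lso Cov s ∧ ccff Cov j ∧ Nonempty (f ≅ s ≫ j) := by
  have := isClosedUnderMapObj_localImage hCov f
  let P := localImage Cov f
  let j : P.fullsubcategory ⟶ Y := P.ι
  have hj : IsFullyFaithful j := fun a =>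
    ⟨inferInstanceAs (P.prop a).ι.Full, inferInstanceAs (P.prop a).ι.Faithful⟩
  obtain ⟨s, ⟨i⟩⟩ := exists_lift hj f fun a x =>
    -- A value of `f` lies in the local image by way of the identity cover.
    ⟨⟨(component f a.as.unop).obj x, a.as.unop, 𝟙 _, x, hCov.of_isIso _ inferInstance,
      ⟨restrIdIso Y _⟩⟩, ⟨Iso.refl _⟩⟩
  have := fun a => (hj a).1
  have := fun a => (hj a).2
  refine ⟨_, s, j, fun U z => ?_, ccff_iff.2 ⟨hj, fun {V U} e he z y ⟨k⟩ => ?_⟩, ⟨i.symm⟩⟩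
  · obtain ⟨V, e, x, he, ⟨k⟩⟩ := z.property
    exact ⟨V, e, x, he, ⟨(j.app ⟨.op V⟩).toFunctor.preimageIso (k ≪≫ (appIso i x).symm)⟩⟩
  · obtain ⟨W, d, x, hd, ⟨l⟩⟩ := z.property
    -- An object locally in the local image is in it, because covers compose.
    exact ⟨⟨y, W, d ≫ e, x, hCov.comp d e hd he,
      ⟨restrCompIso Y d e y ≪≫ (Y.restr d).mapIso k.symm ≪≫ l⟩⟩, ⟨Iso.refl _⟩⟩

end Classes

/-! ### The pointwise pseudopullback of pseudofunctors -/

section PointwisePullback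

variable {B : Type u} [Bicategory.{w, v} B] {X Y Z : B ⥤ᵖ Cat.{v₁, max u₁ v₁}}
  (f : X ⟶ Z) (g : Y ⟶ Z)

/-- The pseudopullback of the components of `f` and `g` at `a`. -/
abbrev PointwisePullback (a : B) :=
  CategoricalPullback (f.app a).toFunctor (g.app a).toFunctor

namespace PointwisePullback

section Iso

variable {f g} {a b c : B} {x : X.obj a} {y : Y.obj a}

/-- The isomorphism component of the restriction of an object of the pointwise pseudopullback. -/
def mapIso (u : a ⟶ b) (i : (f.app a).toFunctor.obj x ≅ (g.app a).toFunctor.obj y) :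
    (f.app b).toFunctor.obj ((X.map u).toFunctor.obj x) ≅
      (g.app b).toFunctor.obj ((Y.map u).toFunctor.obj y) :=
  (Cat.Hom.toNatIso (f.naturality u)).app x ≪≫ (Z.map u).toFunctor.mapIso i ≪≫
    (Cat.Hom.toNatIso (g.naturality u)).symm.app y

/-- This characterizes `mapIso` without inverses; the coherence lemmas below follow from it on
cancelling the constraints of `g`. -/
theorem mapIso_hom_comp (u : a ⟶ b)
    (i : (f.app a).toFunctor.obj x ≅ (g.app a).toFunctor.obj y) :
    (mapIso u i).hom ≫ (g.naturality u).hom.toNatTrans.app y =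
      (f.naturality u).hom.toNatTrans.app x ≫ (Z.map u).toFunctor.map i.hom := by
  change ((f.naturality u).hom.toNatTrans.app x ≫ (Z.map u).toFunctor.map i.hom ≫
    (g.naturality u).inv.toNatTrans.app y) ≫ (g.naturality u).hom.toNatTrans.app y = _
  simp

theorem map_comp_mapIso_hom {x' : X.obj a} {y' : Y.obj a} (u : a ⟶ b)
    (i : (f.app a).toFunctor.obj x ≅ (g.app a).toFunctor.obj y)
    (i' : (f.app a).toFunctor.obj x' ≅ (g.app a).toFunctor.obj y') (φ : x ⟶ x') (ψ : y ⟶ y')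
    (h : (f.app a).toFunctor.map φ ≫ i'.hom = i.hom ≫ (g.app a).toFunctor.map ψ) :
    (f.app b).toFunctor.map ((X.map u).toFunctor.map φ) ≫ (mapIso u i').hom =
      (mapIso u i).hom ≫ (g.app b).toFunctor.map ((Y.map u).toFunctor.map ψ) := by
  rw [← cancel_mono ((g.naturality u).hom.toNatTrans.app y'), Category.assoc, Category.assoc,
    mapIso_hom_comp, naturality_map_hom, reassoc_of% @mapIso_hom_comp,
    reassoc_of% @naturality_map_hom, ← Functor.map_comp, ← Functor.map_comp, h]

theorem map₂_comp_mapIso_hom {u u' : a ⟶ b} (η : u ⟶ u')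
    (i : (f.app a).toFunctor.obj x ≅ (g.app a).toFunctor.obj y) :
    (f.app b).toFunctor.map ((X.map₂ η).toNatTrans.app x) ≫ (mapIso u' i).hom =
      (mapIso u i).hom ≫ (g.app b).toFunctor.map ((Y.map₂ η).toNatTrans.app y) := by
  rw [← cancel_mono ((g.naturality u').hom.toNatTrans.app y), Category.assoc, Category.assoc,
    mapIso_hom_comp, naturality_naturality_app, reassoc_of% @mapIso_hom_comp,
    reassoc_of% @naturality_naturality_app]
  exact congrArg _ ((Z.map₂ η).toNatTrans.naturality i.hom).symm

theorem mapId_comp_iso_hom (i : (f.app a).toFunctor.obj x ≅ (g.app a).toFunctor.obj y) :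
    (f.app a).toFunctor.map ((X.mapId a).hom.toNatTrans.app x) ≫ i.hom =
      (mapIso (𝟙 a) i).hom ≫ (g.app a).toFunctor.map ((Y.mapId a).hom.toNatTrans.app y) := by
  rw [← naturality_id_app, ← naturality_id_app, reassoc_of% @mapIso_hom_comp]
  refine (Category.assoc _ _ _).trans ?_
  exact congrArg _ ((Z.mapId a).hom.toNatTrans.naturality i.hom).symm

theorem mapComp_comp_mapIso_hom (u : a ⟶ b) (t : b ⟶ c)
    (i : (f.app a).toFunctor.obj x ≅ (g.app a).toFunctor.obj y) :
    (f.app c).toFunctor.map ((X.mapComp u t).hom.toNatTrans.app x) ≫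
        (mapIso t (mapIso u i)).hom =
      (mapIso (u ≫ t) i).hom ≫
        (g.app c).toFunctor.map ((Y.mapComp u t).hom.toNatTrans.app y) := by
  refine (cancel_mono ((g.naturality t).hom.toNatTrans.app _ ≫
    (Z.map t).toFunctor.map ((g.naturality u).hom.toNatTrans.app y))).1 ?_
  have h1 : (f.app c).toFunctor.map ((X.mapComp u t).hom.toNatTrans.app x) ≫
      (mapIso t (mapIso u i)).hom ≫ (g.naturality t).hom.toNatTrans.app _ ≫
        (Z.map t).toFunctor.map ((g.naturality u).hom.toNatTrans.app y) =
      (f.naturality (u ≫ t)).hom.toNatTrans.app x ≫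
        (Z.mapComp u t).hom.toNatTrans.app _ ≫
          (Z.map t).toFunctor.map ((Z.map u).toFunctor.map i.hom) := by
    rw [reassoc_of% @mapIso_hom_comp, ← Functor.map_comp, mapIso_hom_comp, Functor.map_comp,
      reassoc_of% @naturality_comp_app]
  have h2 : (mapIso (u ≫ t) i).hom ≫
      (g.app c).toFunctor.map ((Y.mapComp u t).hom.toNatTrans.app y) ≫
        (g.naturality t).hom.toNatTrans.app _ ≫
          (Z.map t).toFunctor.map ((g.naturality u).hom.toNatTrans.app y) =
      (f.naturality (u ≫ t)).hom.toNatTrans.app x ≫ (Z.map (u ≫ t)).toFunctor.map i.hom ≫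
        (Z.mapComp u t).hom.toNatTrans.app _ := by
    rw [← naturality_comp_app, reassoc_of% @mapIso_hom_comp]
  refine (Category.assoc _ _ _).trans (h1.trans (Eq.trans ?_ (h2.symm.trans
    (Category.assoc _ _ _).symm)))
  -- What remains is naturality of the composition constraint of `Z` at `i`.
  exact congrArg _ ((Z.mapComp u t).hom.toNatTrans.naturality i.hom).symm

end Iso

/-- Restriction on the pointwise pseudopullback. -/
def map {a b : B} (u : a ⟶ b) : PointwisePullback f g a ⥤ PointwisePullback f g b where
  obj x := ⟨(X.map u).toFunctor.obj x.fst, (Y.map u).toFunctor.obj x.snd, mapIso u x.iso⟩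
  map {x y} φ :=
    { fst := (X.map u).toFunctor.map φ.fst
      snd := (Y.map u).toFunctor.map φ.snd
      w := map_comp_mapIso_hom u x.iso y.iso φ.fst φ.snd φ.w }
  map_id _ := CategoricalPullback.hom_ext ((X.map u).toFunctor.map_id _)
    ((Y.map u).toFunctor.map_id _)
  map_comp _ _ := CategoricalPullback.hom_ext ((X.map u).toFunctor.map_comp _ _)
    ((Y.map u).toFunctor.map_comp _ _)

/-- The action on 2-cells of the pointwise pseudopullback. -/
def map₂ {a b : B} {u u' : a ⟶ b} (η : u ⟶ u') : map f g u ⟶ map f g u' where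
  app x :=
    { fst := (X.map₂ η).toNatTrans.app x.fst
      snd := (Y.map₂ η).toNatTrans.app x.snd
      w := map₂_comp_mapIso_hom η x.iso }
  naturality _ _ φ := CategoricalPullback.hom_ext
    ((X.map₂ η).toNatTrans.naturality φ.fst) ((Y.map₂ η).toNatTrans.naturality φ.snd)

/-- The unit constraint of the pointwise pseudopullback. -/
def mapId (a : B) : map f g (𝟙 a) ≅ 𝟭 _ :=
  NatIso.ofComponents
    (fun x => CategoricalPullback.mkIso ((Cat.Hom.toNatIso (X.mapId a)).app x.fst)
      ((Cat.Hom.toNatIso (Y.mapId a)).app x.snd) (mapId_comp_iso_hom x.iso))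
    (fun φ => CategoricalPullback.hom_ext
      ((X.mapId a).hom.toNatTrans.naturality φ.fst) ((Y.mapId a).hom.toNatTrans.naturality φ.snd))

/-- The composition constraint of the pointwise pseudopullback. -/
def mapComp {a b c : B} (u : a ⟶ b) (t : b ⟶ c) :
    map f g (u ≫ t) ≅ map f g u ⋙ map f g t :=
  NatIso.ofComponents
    (fun x => CategoricalPullback.mkIso ((Cat.Hom.toNatIso (X.mapComp u t)).app x.fst)
      ((Cat.Hom.toNatIso (Y.mapComp u t)).app x.snd) (mapComp_comp_mapIso_hom u t x.iso))
    (fun φ => CategoricalPullback.hom_ext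
      ((X.mapComp u t).hom.toNatTrans.naturality φ.fst)
      ((Y.mapComp u t).hom.toNatTrans.naturality φ.snd))

end PointwisePullback

open PointwisePullback in
/-- The pointwise pseudopullback of `f` and `g`, as a pseudofunctor. -/
def pointwisePullback : B ⥤ᵖ Cat.{v₁, max u₁ v₁} where
  -- Objects contain a morphism of `Z`, so they stay within bounds because the bound for objects
  -- dominates that for hom-sets.
  obj a := Cat.of (PointwisePullback f g a)
  map u := (map f g u).toCatHom
  map₂ η := (map₂ f g η).toCatHom₂
  -- Morphisms of a pseudopullback are determined by their two projections, so every law reduces to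
  -- those of `X` and `Y`.
  map₂_id u := Cat.Hom₂.ext (NatTrans.ext (funext fun x =>
    CategoricalPullback.hom_ext
    congr(($(X.map₂_id u)).toNatTrans.app x.fst)
    congr(($(Y.map₂_id u)).toNatTrans.app x.snd)))
  map₂_comp η θ := Cat.Hom₂.ext (NatTrans.ext (funext fun x =>
    CategoricalPullback.hom_ext
    congr(($(X.map₂_comp η θ)).toNatTrans.app x.fst)
    congr(($(Y.map₂_comp η θ)).toNatTrans.app x.snd)))
  mapId a := Cat.Hom.isoMk (mapId f g a)
  mapComp u t := Cat.Hom.isoMk (mapComp f g u t)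
  map₂_whisker_left u _ _ η := Cat.Hom₂.ext (NatTrans.ext (funext fun x =>
    CategoricalPullback.hom_ext
    congr(($(X.map₂_whisker_left u η)).toNatTrans.app x.fst)
    congr(($(Y.map₂_whisker_left u η)).toNatTrans.app x.snd)))
  map₂_whisker_right η u := Cat.Hom₂.ext (NatTrans.ext (funext fun x =>
    CategoricalPullback.hom_ext
    congr(($(X.map₂_whisker_right η u)).toNatTrans.app x.fst)
    congr(($(Y.map₂_whisker_right η u)).toNatTrans.app x.snd)))
  map₂_associator u s t := Cat.Hom₂.ext (NatTrans.ext (funext fun x =>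
    CategoricalPullback.hom_ext
    congr(($(X.map₂_associator u s t)).toNatTrans.app x.fst)
    congr(($(Y.map₂_associator u s t)).toNatTrans.app x.snd)))
  map₂_left_unitor u := Cat.Hom₂.ext (NatTrans.ext (funext fun x =>
    CategoricalPullback.hom_ext
    congr(($(X.map₂_left_unitor u)).toNatTrans.app x.fst)
    congr(($(Y.map₂_left_unitor u)).toNatTrans.app x.snd)))
  map₂_right_unitor u := Cat.Hom₂.ext (NatTrans.ext (funext fun x =>
    CategoricalPullback.hom_ext
    congr(($(X.map₂_right_unitor u)).toNatTrans.app x.fst)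
    congr(($(Y.map₂_right_unitor u)).toNatTrans.app x.snd)))

/-- The first projection of the pointwise pseudopullback. -/
def pointwisePullbackFst : pointwisePullback f g ⟶ X :=
  transOfComponents (fun a => CategoricalPullback.π₁ _ _) (fun _ _ => Iso.refl _)
    (fun _ _ _ _ => (Category.comp_id _).trans (Category.id_comp _).symm)
    (fun _ _ => (Category.comp_id _).trans (Category.id_comp _).symm)
    (fun _ _ => Category.id_comp _)
    (fun _ t _ => by
      refine (Category.id_comp _).trans (Eq.symm ?_)
      refine (congrArg _ ((Category.id_comp _).trans ((X.map t).toFunctor.map_id _))).trans ?_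
      exact Category.comp_id _)

/-- The second projection of the pointwise pseudopullback. -/
def pointwisePullbackSnd : pointwisePullback f g ⟶ Y :=
  transOfComponents (fun a => CategoricalPullback.π₂ _ _) (fun _ _ => Iso.refl _)
    (fun _ _ _ _ => (Category.comp_id _).trans (Category.id_comp _).symm)
    (fun _ _ => (Category.comp_id _).trans (Category.id_comp _).symm)
    (fun _ _ => Category.id_comp _)
    (fun _ t _ => by
      refine (Category.id_comp _).trans (Eq.symm ?_)
      refine (congrArg _ ((Category.id_comp _).trans ((Y.map t).toFunctor.map_id _))).trans ?_
      exact Category.comp_id _)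

open PointwisePullback in
/-- The isomorphism filling the pointwise pseudopullback square. -/
def pointwisePullbackIso : pointwisePullbackFst f g ≫ f ≅ pointwisePullbackSnd f g ≫ g :=
  isoOfComponents (fun a x => CategoricalPullback.iso (F := (f.app a).toFunctor) x)
    (fun a _ _ φ => CategoricalPullback.Hom.w φ)
    (fun {a b} u x => by
      have h1 := comp_naturality_app (pointwisePullbackFst f g) f u x
      have h2 := comp_naturality_app (pointwisePullbackSnd f g) g u x
      refine (congrArg _ h2).trans (Eq.trans ?_ (congrArg (· ≫ _) h1.symm))
      have h3 := congrArg (· ≫ (g.naturality u).hom.toNatTrans.app x.snd)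
        (CategoryTheory.Functor.map_id (g.app b).toFunctor ((Y.map u).toFunctor.obj x.snd))
      have h4 := congrArg (· ≫ (f.naturality u).hom.toNatTrans.app x.fst)
        (CategoryTheory.Functor.map_id (f.app b).toFunctor ((X.map u).toFunctor.obj x.fst))
      refine (congrArg _ (h3.trans (Category.id_comp _))).trans
        (Eq.trans ?_ (congrArg (· ≫ _) (h4.trans (Category.id_comp _)).symm))
      exact mapIso_hom_comp u x.iso)

end PointwisePullback

/-! ### Stability of l.s.o. morphisms under pseudopullback -/

section Regular

variable {C : Type u} [Category.{v} C] {Cov : MorphismProperty C}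

open ParamCat

/-- The projections of the pointwise pseudopullback factor, up to isomorphism, through `P` by some
`h`. Local surjectivity of `f` at `g y` produces an object of the pointwise pseudopullback over
`(Ye)y`, and `h` carries it into `P`. -/
theorem lso_of_isPseudopullback {P X Y Z : ParamCat.{v, u, v₂, u₂} C} {p : P ⟶ X} {q : P ⟶ Y}
    {f : X ⟶ Z} {g : Y ⟶ Z} (θ : p ≫ f ≅ q ≫ g) (hθ : IsPseudopullback θ) (hf : lso Cov f) :
    lso Cov q := by
  intro U y
  obtain ⟨V, e, x, he, ⟨i⟩⟩ := hf U ((component g U).obj y)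
  obtain ⟨h, ⟨k⟩⟩ := (hθ (pointwisePullback f g)).essSurj.mem_essImage
    ⟨pointwisePullbackFst f g, pointwisePullbackSnd f g, pointwisePullbackIso f g⟩
  let w : (pointwisePullback f g).obj ⟨.op V⟩ := CategoricalPullback.mk
    (F := component f V) (G := component g V)
    x ((Y.restr e).obj y) (i.symm ≪≫ ((naturalityIso g e).app y).symm)
  exact ⟨V, e, (component h V).obj w, he,
    ⟨(appIso ((CategoricalPullback.π₂ _ _).mapIso k) w).symm⟩⟩

end Regular
end DescentTheory

open DescentTheory in
theorem proposition5p2 {C : Type u} [Category.{v} C] (Cov : MorphismProperty C)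
    (hCov : IsCalculusOfFractions Cov) :
    IsRegularFactorizationSystem
      (lso Cov : MorphismProperty (ParamCat.{v, u, v₂, u₂} C))
      (ccff Cov : MorphismProperty (ParamCat.{v, u, v₂, u₂} C)) where
  left_equivalence e := lso_of_equivalence hCov e
  right_equivalence e := ccff_of_equivalence e
  left_comp _ _ hf hg := lso_comp hCov hf hg
  right_comp _ _ hf hg := ccff_comp hf hg
  exists_factorization f := exists_lso_ccff_factorization hCov f
  fill_in _ _ hs hj := isEquivToPseudopullback_of_lso_of_ccff hs hj
  left_pseudopullback θ hθ hf := lso_of_isPseudopullback θ hθ hf
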